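/- Let $\varphi_1\equiv 1$, $\varphi_{2k}(x)=\sqrt2\cos(kx)$, $\varphi_{2k+1}(x)=\sqrt2\sin(kx)$ for $k\ge 1$ (the Fourier basis). Let $(X,Y)$ be a pair of real random variables of joint law $P$, with $X$ uniformly distributed on $[0,2\pi]$ and $\mathbb E[Y^2]<\infty$, and let $s_*(x)=\mathbb E[Y\mid X=x]$ be the regression function. Write $\langle f,g\rangle=\frac1{2\pi}\int_0^{2\pi}fg$, $\|f\|_2^2=\langle f,f\rangle$, $\beta_k(f)=\langle f,\varphi_k\rangle$, let $\|\cdot\|_\infty$ be the essential supremum norm, and for $\nu,L_1,L_2>0$ let $$\Lambda_\nu(L_1,L_2)=\Big\{f\in L_\infty \ 2\pi\text{-periodic}:\ \sum_{k\ge1}k^\nu|\beta_k(f)|\le L_1\ \text{ and }\ \|f\|_\infty\ge L_2\Big\}.$$ For $D\ge1$ let $m=\mathrm{Span}\{\varphi_1,\dots,\varphi_D\}$ and let $s_m$ be the orthogonal projection of $s_*$ onto $m$ for $\langle\cdot,\cdot\rangle$. Given an i.i.d. sample $(X_i,Y_i)_{i=1}^n$ of law $P$, a least-squares estimator on $m$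 is any $\hat s_m\in\arg\min_{s\in m}\frac1n\sum_{i=1}^n(Y_i-s(X_i))^2$. Theorem. Let $\nu>1/2$. There is a constant $L_\nu>0$ depending only on $\nu$ such that for all $L_1,L_2>0$ there are a constant $C_{\nu,L_1,L_2}>0$ and an integer $n_0=n_0(\nu,L_1,L_2)$, depending only on $\nu,L_1,L_2$, such that for every $\sigma\ge0$ there is a constant $L_{L_1,L_2,\sigma,\nu}>0$, depending only on $L_1,L_2,\sigma,\nu$, for which the following holds. Assume that $s_*\in\Lambda_\nu(L_1,L_2)$, that $\zeta=Y-s_m(X)$ is independent of $X$, that $\mathbb E[\zeta^2]\le\sigma^2$, that $n\ge n_0$, and that $$\Big(\frac{2\sqrt2\,L_1}{L_2}\Big)^{1/\nu}\le D\le L_\nu\Big(\frac n{\ln n}\Big)^{\frac1{2(\nu+1)}}.$$ Then for every $x\in\big(0,\ L_{L_1,L_2,\sigma,\nu}\,n/D^{2(\nu+1)}\big)$ there is an event of probability at least $$1-\exp\!\big(-\beta_0^2n/4\big)-n^{-2}-\frac2x,\qquad \beta_0=\frac{L_2^2}{8\,\big(\sum_{k\ge1}k^{-2\nu}\big)^2L_1^4},$$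 on which every least-squares estimator $\hat s_m$ on $m$ satisfies $$\|\hat s_m-s_m\|_2^2\le C_{\nu,L_1,L_2}\,\frac{\sigma^2Dx}{n}.$$ -/

import Mathlib

open MeasureTheory ProbabilityTheory

noncomputable section

namespace FourierERM

/-- The law of the design: the uniform distribution on `[0, 2π]`. -/
def designLaw : Measure ℝ := cond volume (Set.Icc 0 (2 * Real.pi))

/-- The Fourier basis `φ₁ = 1`, `φ_{2j}(x) = √2 cos (j x)`, `φ_{2j+1}(x) = √2 sin (j x)` for `j ≥ 1`
(only the indices `k ≥ 1` are used; `k / 2` is the integer quotient). -/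
def fourierFun (k : ℕ) (x : ℝ) : ℝ :=
  if k = 1 then 1
  else if Even k then √2 * Real.cos ((k / 2 : ℕ) * x)
  else √2 * Real.sin ((k / 2 : ℕ) * x)

/-- The linear model spanned by the first `D` Fourier functions `φ₁, …, φ_D`. -/
def fourierModel (D : ℕ) : Submodule ℝ (ℝ → ℝ) :=
  Submodule.span ℝ (fourierFun '' Set.Icc 1 D)

/-- The scalar product of `L₂` of the design law. -/
def innerL2 (f g : ℝ → ℝ) : ℝ := ∫ x, f x * g x ∂designLaw

/-- The squared norm of `L₂` of the design law. -/
def normSqL2 (f : ℝ → ℝ) : ℝ := ∫ x, f x ^ 2 ∂designLaw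

/-- The Fourier coefficient `β_k(f) = ⟨f, φ_k⟩`. -/
def fourierCoef (f : ℝ → ℝ) (k : ℕ) : ℝ := innerL2 f (fourierFun k)

/-- `Λ_ν(L₁, L₂)`: the `2π`-periodic essentially bounded functions with
`∑_{k ≥ 1} k^ν |β_k(f)| ≤ L₁` and `‖f‖_∞ ≥ L₂` (essential supremum norm). The sum over `k ≥ 1` is
written with `k = j + 1`. -/
def LambdaClass (ν L₁ L₂ : ℝ) : Set (ℝ → ℝ) :=
  {f | Function.Periodic f (2 * Real.pi) ∧ MemLp f ⊤ designLaw ∧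
    Summable (fun j : ℕ => ((j + 1 : ℕ) : ℝ) ^ ν * |fourierCoef f (j + 1)|) ∧
    ∑' j : ℕ, ((j + 1 : ℕ) : ℝ) ^ ν * |fourierCoef f (j + 1)| ≤ L₁ ∧
    ENNReal.ofReal L₂ ≤ eLpNorm f ⊤ designLaw}

/-- `s` is a version of the regression function `x ↦ E[Y | X = x]`, where `P` is the law of
`(X, Y)`. -/
def IsRegressionFunction (P : Measure (ℝ × ℝ)) (s : ℝ → ℝ) : Prop :=
  (fun p : ℝ × ℝ => s p.1) =ᵐ[P]
    P[(fun p : ℝ × ℝ => p.2) | MeasurableSpace.comap Prod.fst inferInstance]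

/-- `sm` is the orthogonal projection of `s` onto the model `m`, in `L₂` of the design law. -/
def IsProjection (m : Submodule ℝ (ℝ → ℝ)) (s sm : ℝ → ℝ) : Prop :=
  sm ∈ m ∧ ∀ t ∈ m, innerL2 (fun x => s x - sm x) t = 0

/-- The empirical risk `R_n(s) = (1/n) ∑ᵢ (Yᵢ - s(Xᵢ))²` on the data `z i = (Xᵢ, Yᵢ)`. -/
def empiricalRisk {n : ℕ} (z : Fin n → ℝ × ℝ) (s : ℝ → ℝ) : ℝ :=
  (1 / (n : ℝ)) * ∑ i, ((z i).2 - s (z i).1) ^ 2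

/-- `s` is a least-squares estimator on the model `m` for the data `z`. -/
def IsLeastSquares {n : ℕ} (m : Submodule ℝ (ℝ → ℝ)) (z : Fin n → ℝ × ℝ) (s : ℝ → ℝ) : Prop :=
  s ∈ m ∧ ∀ t ∈ m, empiricalRisk z s ≤ empiricalRisk z t

/-- The small-ball constant `β₀ = C_ν⁻² L₂² L₁⁻⁴ / 8`, with `C_ν = ∑_{k ≥ 1} k^{-2ν}`
(and `k = j + 1`). -/
def smallBallConst (ν L₁ L₂ : ℝ) : ℝ :=
  L₂ ^ 2 / (8 * (∑' j : ℕ, ((j + 1 : ℕ) : ℝ) ^ (-2 * ν)) ^ 2 * L₁ ^ 4)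

end FourierERM

end

/-!
The noise `ζ = Y - s_m(X)` is centred, because `E[ζ] = E[(s - s_m)(X)]` and `s - s_m` is orthogonal
to the constant function `φ₁` (`integral_sub_projection_eq_zero`). Since `ζ` is also independent of
`X`, it satisfies `E[ζ | X] = 0`: the data follow a regression model whose regression function `s_m`
lies in the model, and there is no approximation error to control.

Let `δ` be the coefficient vector of `ŝ - s_m`, let `G` be the empirical Gram matrix of
`φ₁, …, φ_D`, and let `W_k = (1/n) ∑ᵢ ζᵢ φₖ(Xᵢ)`. Comparing the empirical risks of `ŝ` and `s_m`
gives `⟨δ, G δ⟩ ≤ 2 ⟨δ, W⟩`. If each entry of `G` is within `1/(2D)` of the identity matrix, then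
`⟨δ, G δ⟩ ≥ |δ|² / 2`, so that `‖ŝ - s_m‖² = |δ|² ≤ 16 |W|²`
(`normSqL2_sub_le_of_isLeastSquares`).

The products `φⱼ φₖ` are bounded by `2` and the basis is orthonormal for the law of the design, so
Hoeffding's inequality and a union bound over the `D²` entries control `G`: the exponent
`1 / (2(ν + 1))` is at most `1/2`, hence the upper bound on `D` makes `D² log n / n` small enough for
the exceptional probability to be at most `n⁻²` (`dim_sq_mul_log_le`, `union_bound_le`). Finally `E|W|² ≤ σ² D / n`
(`noise_mul_fourierFun`, `integral_mean_sq_eq`), and Markov's inequality gives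
`|W|² ≤ σ² D x / n` outside an event of probability `1 / x`.
-/

namespace FourierERM

/-! ### The Fourier basis and the design law -/

lemma integral_designLaw (f : ℝ → ℝ) :
    ∫ x, f x ∂designLaw = (2 * Real.pi)⁻¹ * ∫ x in (0 : ℝ)..(2 * Real.pi), f x := by
  have h : (0 : ℝ) ≤ 2 * Real.pi := by positivity
  rw [designLaw, ProbabilityTheory.cond, integral_smul_measure, intervalIntegral.integral_of_le h,
    integral_Icc_eq_integral_Ioc, Real.volume_Icc]
  simp [ENNReal.toReal_inv, Real.pi_pos.le]

instance isProbabilityMeasure_designLaw : IsProbabilityMeasure designLaw := by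
  apply cond_isProbabilityMeasure_of_finite
  · simp [Real.volume_Icc, Real.pi_pos]
  · rw [Real.volume_Icc]
    exact ENNReal.ofReal_ne_top

lemma continuous_fourierFun (k : ℕ) : Continuous (fourierFun k) := by
  unfold fourierFun
  split_ifs <;> fun_prop

lemma abs_fourierFun_le (k : ℕ) (x : ℝ) : |fourierFun k x| ≤ √2 := by
  unfold fourierFun
  split_ifs
  · simp
  · rw [abs_mul, abs_of_nonneg (Real.sqrt_nonneg 2)]
    exact mul_le_of_le_one_right (Real.sqrt_nonneg 2) (Real.abs_cos_le_one _)
  · rw [abs_mul, abs_of_nonneg (Real.sqrt_nonneg 2)]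
    exact mul_le_of_le_one_right (Real.sqrt_nonneg 2) (Real.abs_sin_le_one _)

lemma abs_fourierFun_mul_le (j k : ℕ) (x : ℝ) : |fourierFun j x * fourierFun k x| ≤ 2 := by
  rw [abs_mul]
  calc |fourierFun j x| * |fourierFun k x| ≤ √2 * √2 := by
        gcongr <;> exact abs_fourierFun_le _ _
    _ = 2 := Real.mul_self_sqrt (by norm_num)

lemma integral_cos_int_mul (m : ℤ) :
    ∫ x in (0 : ℝ)..(2 * Real.pi), Real.cos (m * x) = if m = 0 then 2 * Real.pi else 0 := by
  split_ifs with h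
  · simp [h]
  · have hm : (m : ℝ) ≠ 0 := by exact_mod_cast h
    rw [intervalIntegral.integral_comp_mul_left (fun x => Real.cos x) hm, integral_cos]
    have : Real.sin (m * (2 * Real.pi)) = 0 := by
      have := Real.sin_int_mul_pi (m * 2)
      push_cast at this
      rwa [mul_assoc] at this
    simp [this]

lemma integral_sin_int_mul (m : ℤ) :
    ∫ x in (0 : ℝ)..(2 * Real.pi), Real.sin (m * x) = 0 := by
  rcases eq_or_ne m 0 with h | h
  · simp [h]
  · have hm : (m : ℝ) ≠ 0 := by exact_mod_cast h
    rw [intervalIntegral.integral_comp_mul_left (fun x => Real.sin x) hm, integral_sin]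
    simp [Real.cos_int_mul_two_pi]

lemma integral_cos_mul_cos (a b : ℕ) :
    ∫ x in (0 : ℝ)..(2 * Real.pi), Real.cos (a * x) * Real.cos (b * x) =
      2⁻¹ * ((if (a : ℤ) - b = 0 then 2 * Real.pi else 0)
        + (if (a : ℤ) + b = 0 then 2 * Real.pi else 0)) := by
  rw [← integral_cos_int_mul, ← integral_cos_int_mul, ← intervalIntegral.integral_add
    (Continuous.intervalIntegrable (by fun_prop) _ _)
    (Continuous.intervalIntegrable (by fun_prop) _ _), ← intervalIntegral.integral_const_mul]
  congr 1 with x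
  push_cast
  rw [sub_mul, add_mul, Real.cos_sub, Real.cos_add]
  ring

lemma integral_sin_mul_sin (a b : ℕ) :
    ∫ x in (0 : ℝ)..(2 * Real.pi), Real.sin (a * x) * Real.sin (b * x) =
      2⁻¹ * ((if (a : ℤ) - b = 0 then 2 * Real.pi else 0)
        - (if (a : ℤ) + b = 0 then 2 * Real.pi else 0)) := by
  rw [← integral_cos_int_mul, ← integral_cos_int_mul, ← intervalIntegral.integral_sub
    (Continuous.intervalIntegrable (by fun_prop) _ _)
    (Continuous.intervalIntegrable (by fun_prop) _ _), ← intervalIntegral.integral_const_mul]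
  congr 1 with x
  push_cast
  rw [sub_mul, add_mul, Real.cos_sub, Real.cos_add]
  ring

lemma integral_sin_mul_cos (a b : ℕ) :
    ∫ x in (0 : ℝ)..(2 * Real.pi), Real.sin (a * x) * Real.cos (b * x) = 0 := by
  have h : ∀ x : ℝ, Real.sin (a * x) * Real.cos (b * x) =
      2⁻¹ * (Real.sin (((a - b : ℤ) : ℝ) * x) + Real.sin (((a + b : ℤ) : ℝ) * x)) := fun x => by
    push_cast
    rw [sub_mul, add_mul, Real.sin_sub, Real.sin_add]
    ring
  simp_rw [h]
  rw [intervalIntegral.integral_const_mul, intervalIntegral.integral_add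
    (Continuous.intervalIntegrable (by fun_prop) _ _)
    (Continuous.intervalIntegrable (by fun_prop) _ _), integral_sin_int_mul, integral_sin_int_mul]
  simp

/-- Orthonormality of the Fourier basis for the design law. -/
lemma integral_fourierFun_mul {j k : ℕ} (hj : 1 ≤ j) (hk : 1 ≤ k) :
    ∫ x, fourierFun j x * fourierFun k x ∂designLaw = if j = k then 1 else 0 := by
  have hs : √2 * √2 = (2 : ℝ) := Real.mul_self_sqrt (by norm_num)
  have hpi : Real.pi ≠ 0 := Real.pi_ne_zero
  rw [integral_designLaw]
  -- every basis function is a multiple of `cos (a x)`, with `a = 0` for the constant, or `sin (a x)`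
  have key : ∀ i : ℕ, 1 ≤ i →
      (i = 1 ∧ fourierFun i = fun x => 1 * Real.cos ((0 : ℕ) * x)) ∨
      (∃ a, 1 ≤ a ∧ i = 2 * a ∧ fourierFun i = fun x => √2 * Real.cos (a * x)) ∨
      (∃ a, 1 ≤ a ∧ i = 2 * a + 1 ∧ fourierFun i = fun x => √2 * Real.sin (a * x)) := by
    intro i hi
    rcases eq_or_ne i 1 with h1 | h1
    · left
      exact ⟨h1, by ext x; simp [fourierFun, h1]⟩
    · right
      rcases Nat.even_or_odd i with h | h
      · left
        exact ⟨i / 2, by lia, by obtain ⟨r, hr⟩ := h; lia, by ext x; simp [fourierFun, h1, h]⟩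
      · right
        refine ⟨i / 2, by lia, by obtain ⟨r, hr⟩ := h; lia, ?_⟩
        ext x
        simp [fourierFun, h1, Nat.not_even_iff_odd.2 h]
  have cc : ∀ (c d : ℝ) (a b : ℕ), ∫ x in (0 : ℝ)..(2 * Real.pi),
      (c * Real.cos (a * x)) * (d * Real.cos (b * x)) = c * d *
      (2⁻¹ * ((if (a : ℤ) - b = 0 then 2 * Real.pi else 0)
        + (if (a : ℤ) + b = 0 then 2 * Real.pi else 0))) := fun c d a b => by
    rw [← integral_cos_mul_cos, ← intervalIntegral.integral_const_mul]
    congr 1 with x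
    ring
  have ss : ∀ (c d : ℝ) (a b : ℕ), ∫ x in (0 : ℝ)..(2 * Real.pi),
      (c * Real.sin (a * x)) * (d * Real.sin (b * x)) = c * d *
      (2⁻¹ * ((if (a : ℤ) - b = 0 then 2 * Real.pi else 0)
        - (if (a : ℤ) + b = 0 then 2 * Real.pi else 0))) := fun c d a b => by
    rw [← integral_sin_mul_sin, ← intervalIntegral.integral_const_mul]
    congr 1 with x
    ring
  have sc : ∀ (c d : ℝ) (a b : ℕ), ∫ x in (0 : ℝ)..(2 * Real.pi),
      (c * Real.sin (a * x)) * (d * Real.cos (b * x)) = 0 := fun c d a b => by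
    simp_rw [mul_mul_mul_comm c]
    rw [intervalIntegral.integral_const_mul, integral_sin_mul_cos, mul_zero]
  have cs : ∀ (c d : ℝ) (a b : ℕ), ∫ x in (0 : ℝ)..(2 * Real.pi),
      (c * Real.cos (a * x)) * (d * Real.sin (b * x)) = 0 := fun c d a b => by
    simp_rw [mul_comm (c * _)]
    exact sc d c b a
  rcases key j hj with ⟨h1, hf⟩ | ⟨a, ha, h1, hf⟩ | ⟨a, ha, h1, hf⟩ <;>
  rcases key k hk with ⟨h2, hg⟩ | ⟨b, hb, h2, hg⟩ | ⟨b, hb, h2, hg⟩ <;>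
  rw [hf, hg] <;> simp only [cc, ss, sc, cs, hs, mul_zero]
  · rw [if_pos (by lia), if_pos (by lia), if_pos (by lia)]; field_simp; norm_num
  · rw [if_neg (by lia), if_neg (by lia), if_neg (by lia)]; simp
  · rw [if_neg (by lia)]
  · rw [if_neg (by lia), if_neg (by lia), if_neg (by lia)]; simp
  · rw [if_neg (c := (a : ℤ) + b = 0) (by lia)]
    by_cases h : a = b
    · rw [if_pos (by lia), if_pos (by lia)]; field_simp; norm_num
    · rw [if_neg (by lia), if_neg (by lia)]; simp
  · rw [if_neg (by lia)]
  · rw [if_neg (by lia)]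
  · rw [if_neg (by lia)]
  · rw [if_neg (c := (a : ℤ) + b = 0) (by lia)]
    by_cases h : a = b
    · rw [if_pos (by lia), if_pos (by lia)]; field_simp; norm_num
    · rw [if_neg (by lia), if_neg (by lia)]; simp

lemma integrable_designLaw_of_continuous {f : ℝ → ℝ} (hf : Continuous f) :
    Integrable f designLaw := by
  rw [designLaw, ProbabilityTheory.cond]
  refine Integrable.smul_measure ?_ (by simp [Real.volume_Icc, Real.pi_pos])
  exact hf.continuousOn.integrableOn_Icc

lemma mem_fourierModel_iff {D : ℕ} {f : ℝ → ℝ} :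
    f ∈ fourierModel D ↔ ∃ c : ℕ → ℝ, f = fun x => ∑ k ∈ Finset.Icc 1 D, c k * fourierFun k x := by
  rw [fourierModel, ← Finset.coe_Icc, Submodule.mem_span_image_finset_iff_exists_fun']
  constructor
  · rintro ⟨c, rfl⟩
    exact ⟨c, by ext x; simp⟩
  · rintro ⟨c, rfl⟩
    exact ⟨c, by ext x; simp⟩

lemma continuous_of_mem_fourierModel {D : ℕ} {f : ℝ → ℝ} (hf : f ∈ fourierModel D) :
    Continuous f := by
  obtain ⟨c, rfl⟩ := mem_fourierModel_iff.1 hf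
  exact continuous_finsetSum _ fun k _ => (continuous_fourierFun k).const_mul (c k)

/-- Parseval's identity in the model. -/
lemma normSqL2_sum_fourierFun (D : ℕ) (c : ℕ → ℝ) :
    normSqL2 (fun x => ∑ k ∈ Finset.Icc 1 D, c k * fourierFun k x) =
      ∑ k ∈ Finset.Icc 1 D, c k ^ 2 := by
  have hI : ∀ j k, Integrable (fun x => c j * fourierFun j x * (c k * fourierFun k x)) designLaw :=
    fun j k => integrable_designLaw_of_continuous
      (((continuous_fourierFun j).const_mul _).mul ((continuous_fourierFun k).const_mul _))
  unfold normSqL2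
  simp_rw [sq, Finset.sum_mul_sum]
  rw [integral_finsetSum _ fun j _ => integrable_finsetSum _ fun k _ => hI j k]
  refine Finset.sum_congr rfl fun j hj => ?_
  rw [integral_finsetSum _ fun k _ => hI j k]
  have : ∀ k ∈ Finset.Icc 1 D, ∫ x, c j * fourierFun j x * (c k * fourierFun k x) ∂designLaw =
      if j = k then c j * c k else 0 := fun k hk => by
    rw [Finset.mem_Icc] at hj hk
    simp_rw [mul_mul_mul_comm (c j) _ (c k)]
    rw [integral_const_mul, integral_fourierFun_mul hj.1 hk.1]
    simp
  rw [Finset.sum_congr rfl this, Finset.sum_ite_eq, if_pos hj]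

/-! ### The deterministic comparison -/

/-- A quadratic form `∑ cⱼ cₖ Gⱼₖ` whose matrix differs from the identity by at most `1 / (2D)` in
each entry is at least half the squared norm. -/
lemma half_sum_sq_le_of_gram_close {D : ℕ} (hD : 1 ≤ D) (G : ℕ → ℕ → ℝ)
    (hG : ∀ j ∈ Finset.Icc 1 D, ∀ k ∈ Finset.Icc 1 D,
      |G j k - if j = k then 1 else 0| ≤ 1 / (2 * D)) (c : ℕ → ℝ) :
    (∑ k ∈ Finset.Icc 1 D, c k ^ 2) / 2 ≤
      ∑ j ∈ Finset.Icc 1 D, ∑ k ∈ Finset.Icc 1 D, c j * c k * G j k := by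
  have hD' : (0 : ℝ) < D := by exact_mod_cast hD
  set S := Finset.Icc 1 D
  have h1 : ∀ j ∈ S, ∀ k ∈ S, c j * c k * (if j = k then 1 else 0) - |c j| * |c k| * (1 / (2 * D))
      ≤ c j * c k * G j k := by
    intro j hj k hk
    have h2 : |c j * c k * (G j k - if j = k then 1 else 0)| ≤ |c j| * |c k| * (1 / (2 * D)) := by
      rw [abs_mul, abs_mul]
      exact mul_le_mul_of_nonneg_left (hG j hj k hk) (by positivity)
    have := (abs_le.1 h2).1
    linarith [mul_sub (c j * c k) (G j k) (if j = k then 1 else 0)]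
  have h2 := Finset.sum_le_sum fun j hj => Finset.sum_le_sum (h1 j hj)
  have h3 : ∑ j ∈ S, ∑ k ∈ S, (c j * c k * (if j = k then 1 else 0)
      - |c j| * |c k| * (1 / (2 * D))) =
      ∑ k ∈ S, c k ^ 2 - (∑ k ∈ S, |c k|) ^ 2 * (1 / (2 * D)) := by
    simp_rw [Finset.sum_sub_distrib]
    congr 1
    · refine Finset.sum_congr rfl fun j hj => ?_
      simp_rw [mul_ite, mul_one, mul_zero]
      rw [Finset.sum_ite_eq, if_pos hj, sq]
    · rw [sq, Finset.sum_mul_sum, Finset.sum_mul]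
      exact Finset.sum_congr rfl fun j _ => by rw [Finset.sum_mul]
  have h4 : (∑ k ∈ S, |c k|) ^ 2 ≤ D * ∑ k ∈ S, c k ^ 2 := by
    have := sq_sum_le_card_mul_sum_sq (s := S) (f := fun k => |c k|)
    simpa [S] using this
  have h5 : (∑ k ∈ S, |c k|) ^ 2 * (1 / (2 * D)) ≤ (∑ k ∈ S, c k ^ 2) / 2 := by
    calc _ ≤ (D * ∑ k ∈ S, c k ^ 2) * (1 / (2 * D)) := by gcongr
      _ = _ := by field_simp
  linarith

/-- On a design whose empirical Gram matrix is close to the identity, the loss of every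
least-squares estimator is controlled by the noise terms `(1/n) ∑ᵢ ζᵢ φₖ(Xᵢ)`. -/
lemma normSqL2_sub_le_of_isLeastSquares {n D : ℕ} (hD : 1 ≤ D) (z : Fin n → ℝ × ℝ)
    {sm shat : ℝ → ℝ} (hsm : sm ∈ fourierModel D)
    (hG : ∀ j ∈ Finset.Icc 1 D, ∀ k ∈ Finset.Icc 1 D,
      |1 / (n : ℝ) * ∑ i, fourierFun j (z i).1 * fourierFun k (z i).1 - if j = k then 1 else 0|
        ≤ 1 / (2 * D))
    (hshat : IsLeastSquares (fourierModel D) z shat) :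
    normSqL2 (fun u => shat u - sm u) ≤
      16 * ∑ k ∈ Finset.Icc 1 D,
        (1 / (n : ℝ) * ∑ i, ((z i).2 - sm (z i).1) * fourierFun k (z i).1) ^ 2 := by
  obtain ⟨c, hc⟩ := mem_fourierModel_iff.1 (sub_mem hshat.1 hsm)
  have hd : ∀ u, shat u - sm u = ∑ k ∈ Finset.Icc 1 D, c k * fourierFun k u :=
    fun u => congrFun hc u
  simp_rw [hd]
  rw [normSqL2_sum_fourierFun]
  have hq := half_sum_sq_le_of_gram_close hD _ hG c
  set S := Finset.Icc 1 D
  set W : ℕ → ℝ := fun k => 1 / (n : ℝ) * ∑ i, ((z i).2 - sm (z i).1) * fourierFun k (z i).1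
  -- the empirical quadratic form is the empirical mean of `(ŝ - s_m)²`
  have hquad : ∑ j ∈ S, ∑ k ∈ S, c j * c k *
      (1 / (n : ℝ) * ∑ i, fourierFun j (z i).1 * fourierFun k (z i).1) =
      1 / (n : ℝ) * ∑ i, (shat (z i).1 - sm (z i).1) ^ 2 := by
    simp_rw [hd, sq, Finset.sum_mul_sum, Finset.mul_sum]
    symm
    rw [Finset.sum_comm]
    refine Finset.sum_congr rfl fun j _ => ?_
    rw [Finset.sum_comm]
    exact Finset.sum_congr rfl fun k _ => Finset.sum_congr rfl fun i _ => by ring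
  have hlin : ∑ k ∈ S, c k * W k =
      1 / (n : ℝ) * ∑ i, ((z i).2 - sm (z i).1) * (shat (z i).1 - sm (z i).1) := by
    simp_rw [hd, W, Finset.mul_sum]
    symm
    rw [Finset.sum_comm]
    exact Finset.sum_congr rfl fun k _ => Finset.sum_congr rfl fun i _ => by ring
  have hbasic : 1 / (n : ℝ) * ∑ i, (shat (z i).1 - sm (z i).1) ^ 2 ≤ 2 * ∑ k ∈ S, c k * W k := by
    have h := hshat.2 sm hsm
    unfold empiricalRisk at h
    have h' : 1 / (n : ℝ) * ∑ i, ((z i).2 - shat (z i).1) ^ 2 =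
        1 / (n : ℝ) * ∑ i, ((z i).2 - sm (z i).1) ^ 2
        - 2 * (1 / (n : ℝ) * ∑ i, ((z i).2 - sm (z i).1) * (shat (z i).1 - sm (z i).1))
        + 1 / (n : ℝ) * ∑ i, (shat (z i).1 - sm (z i).1) ^ 2 := by
      simp_rw [Finset.mul_sum]
      rw [← Finset.sum_sub_distrib, ← Finset.sum_add_distrib]
      exact Finset.sum_congr rfl fun i _ => by ring
    linarith
  have hcs := Finset.sum_mul_sq_le_sq_mul_sq S c W
  set A := ∑ k ∈ S, c k ^ 2
  set B := ∑ k ∈ S, W k ^ 2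
  have hA : 0 ≤ A := Finset.sum_nonneg fun k _ => sq_nonneg _
  have hB : 0 ≤ B := Finset.sum_nonneg fun k _ => sq_nonneg _
  have h4 : A ≤ 4 * ∑ k ∈ S, c k * W k := by linarith
  change A ≤ 16 * B
  rcases hA.eq_or_lt with h0 | h0
  · linarith
  · have : A ^ 2 ≤ 16 * (A * B) := by
      calc A ^ 2 ≤ (4 * ∑ k ∈ S, c k * W k) ^ 2 := by gcongr
        _ ≤ _ := by linarith
    exact le_of_mul_le_mul_left (by linarith) h0

/-! ### Concentration of the empirical Gram matrix -/

/-- Two-sided Hoeffding inequality for the mean of `g (Z i)`, where `|g| ≤ 2`. -/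
lemma measureReal_lt_abs_mean_sub_le {Ω E : Type*} [MeasurableSpace Ω] [MeasurableSpace E]
    {μ : Measure Ω} [IsProbabilityMeasure μ] {P : Measure E} {n : ℕ} (hn : 0 < n)
    {Z : Fin n → Ω → E} (hZ : ∀ i, Measurable (Z i)) (hind : iIndepFun Z μ)
    (hlaw : ∀ i, μ.map (Z i) = P) {g : E → ℝ} (hg : Measurable g) (hb : ∀ e, |g e| ≤ 2)
    {t : ℝ} (ht : 0 ≤ t) :
    μ.real {ω | t < |1 / (n : ℝ) * ∑ i, g (Z i ω) - ∫ e, g e ∂P|} ≤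
      2 * Real.exp (-(n * t ^ 2 / 8)) := by
  have hn' : (0 : ℝ) < n := by exact_mod_cast hn
  set m := ∫ e, g e ∂P
  have hm : ∀ i, ∫ ω, g (Z i ω) ∂μ = m := fun i => by
    rw [← integral_map (hZ i).aemeasurable hg.aestronglyMeasurable, hlaw i]
  have hsub : ∀ i, HasSubgaussianMGF (fun ω => g (Z i ω) - m) 4 μ := fun i => by
    have h := hasSubgaussianMGF_of_mem_Icc (μ := μ) (X := fun ω => g (Z i ω)) (a := -2) (b := 2)
      (hg.comp (hZ i)).aemeasurable (ae_of_all _ fun ω => Set.mem_Icc.2 (abs_le.1 (hb _)))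
    rw [hm i] at h
    convert h using 1
    ext
    norm_num
  have hind' : iIndepFun (fun i ω => g (Z i ω) - m) μ :=
    hind.comp (fun _ e => g e - m) fun _ => hg.sub_const m
  have hind'' : iIndepFun (fun i ω => -(g (Z i ω) - m)) μ :=
    hind.comp (fun _ e => -(g e - m)) fun _ => (hg.sub_const m).neg
  have hnt : 0 ≤ n * t := by positivity
  have h1 := HasSubgaussianMGF.measure_sum_ge_le_of_iIndepFun hind' (c := fun _ => 4)
    (s := Finset.univ) (fun i _ => hsub i) hnt
  have h2 := HasSubgaussianMGF.measure_sum_ge_le_of_iIndepFun hind'' (c := fun _ => 4)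
    (s := Finset.univ) (fun i _ => (hsub i).neg) hnt
  have he : -(n * t) ^ 2 / (2 * ∑ _i : Fin n, (((4 : NNReal)) : ℝ)) = -(n * t ^ 2 / 8) := by
    simp
    field_simp
    ring
  rw [NNReal.coe_sum, he] at h1 h2
  refine (measureReal_mono (s₂ := {ω | n * t ≤ ∑ i, (g (Z i ω) - m)} ∪
    {ω | n * t ≤ ∑ i, -(g (Z i ω) - m)}) ?_).trans ((measureReal_union_le _ _).trans (by linarith))
  intro ω hω
  have hs : ∑ i, (g (Z i ω) - m) = n * (1 / (n : ℝ) * ∑ i, g (Z i ω) - m) := by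
    rw [Finset.sum_sub_distrib]
    simp
    field_simp
  rw [Set.mem_union, Set.mem_ofPred_eq, Set.mem_ofPred_eq, Finset.sum_neg_distrib, hs, ← mul_neg]
  rcases lt_abs.1 (show t < |_| from hω) with h | h
  · exact Or.inl (by gcongr)
  · exact Or.inr (by gcongr)

/-- With `Lν = 1/13`, the upper bound on the dimension gives `169 D² log n ≤ n`. -/
lemma dim_sq_mul_log_le {ν : ℝ} (hν : 1 / 2 < ν) {n D : ℕ} (hn : 2 ≤ n)
    (hD : (D : ℝ) ≤ 1 / 13 * ((n : ℝ) / Real.log n) ^ (1 / (2 * (ν + 1)))) :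
    169 * (D : ℝ) ^ 2 * Real.log n ≤ n := by
  have hn' : (2 : ℝ) ≤ n := by exact_mod_cast hn
  have hlog : 0 < Real.log n := Real.log_pos (by linarith)
  have h1 : 1 ≤ (n : ℝ) / Real.log n := by
    rw [one_le_div hlog]
    linarith [Real.log_le_sub_one_of_pos (show (0 : ℝ) < n by linarith)]
  have h2 : ((n : ℝ) / Real.log n) ^ (1 / (2 * (ν + 1))) ≤ √((n : ℝ) / Real.log n) := by
    rw [Real.sqrt_eq_rpow]
    apply Real.rpow_le_rpow_of_exponent_le h1
    apply one_div_le_one_div_of_le <;> linarith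
  have h3 : 13 * (D : ℝ) ≤ √((n : ℝ) / Real.log n) := by linarith
  have h4 : (13 * (D : ℝ)) ^ 2 ≤ (n : ℝ) / Real.log n := by
    calc _ ≤ √((n : ℝ) / Real.log n) ^ 2 := by gcongr
      _ = _ := Real.sq_sqrt (by linarith)
  rw [le_div_iff₀ hlog] at h4
  linarith

/-- The union bound over the `D²` entries of the Gram matrix costs at most `n⁻²`. -/
lemma union_bound_le {n D : ℕ} (hn : 2 ≤ n) (hD : 1 ≤ D)
    (h : 169 * (D : ℝ) ^ 2 * Real.log n ≤ n) :
    (D : ℝ) ^ 2 * (2 * Real.exp (-(n * (1 / (2 * (D : ℝ))) ^ 2 / 8))) ≤ 1 / (n : ℝ) ^ 2 := by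
  have hn' : (2 : ℝ) ≤ n := by exact_mod_cast hn
  have hD' : (1 : ℝ) ≤ D := by exact_mod_cast hD
  have hlog : 1 / 2 ≤ Real.log n := by
    have := Real.log_le_log (by norm_num) hn'
    linarith [Real.log_two_gt_d9]
  have h1 : 5 * Real.log n ≤ n * (1 / (2 * (D : ℝ))) ^ 2 / 8 := by
    have : n * (1 / (2 * (D : ℝ))) ^ 2 / 8 = n / (32 * (D : ℝ) ^ 2) := by
      field_simp
      norm_num
    rw [this, le_div_iff₀ (by positivity)]
    nlinarith [sq_nonneg (D : ℝ)]
  have h2 : Real.exp (-(n * (1 / (2 * (D : ℝ))) ^ 2 / 8)) ≤ 1 / (n : ℝ) ^ 5 := by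
    calc _ ≤ Real.exp (-(5 * Real.log n)) := Real.exp_le_exp.2 (by linarith)
      _ = _ := by
        rw [Real.exp_neg, ← Real.exp_log (show (0 : ℝ) < (n : ℝ) ^ 5 by positivity), Real.log_pow]
        simp
  have h3 : (D : ℝ) ^ 2 * 2 ≤ n := by nlinarith [sq_nonneg (D : ℝ)]
  calc _ = ((D : ℝ) ^ 2 * 2) * Real.exp (-(n * (1 / (2 * (D : ℝ))) ^ 2 / 8)) := by ring
    _ ≤ n * (1 / (n : ℝ) ^ 5) := by gcongr
    _ = 1 / (n : ℝ) ^ 4 := by field_simp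
    _ ≤ 1 / (n : ℝ) ^ 2 := by
      apply one_div_le_one_div_of_le (by positivity)
      exact pow_le_pow_right₀ (by linarith) (by norm_num)

/-! ### The noise terms -/

/-- The noise is centred: `E[Y - s(X)] = 0`, and `s - s_m` is orthogonal to the constant `φ₁`. -/
lemma integral_sub_projection_eq_zero {D : ℕ} (hD : 1 ≤ D) {P : Measure (ℝ × ℝ)}
    [IsProbabilityMeasure P] {s sm : ℝ → ℝ} (hX : P.map Prod.fst = designLaw)
    (hY : MemLp (fun p : ℝ × ℝ => p.2) 2 P) (hs : IsRegressionFunction P s)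
    (hsL : MemLp s ⊤ designLaw) (hsm : IsProjection (fourierModel D) s sm) :
    ∫ p, (p.2 - sm p.1) ∂P = 0 := by
  have hcont := continuous_of_mem_fourierModel hsm.1
  have hismD := integrable_designLaw_of_continuous hcont
  have hism : Integrable (fun p : ℝ × ℝ => sm p.1) P := by
    rw [← hX] at hismD
    exact hismD.comp_measurable measurable_fst
  have hY1 : ∫ p, p.2 ∂P = ∫ x, s x ∂designLaw := by
    rw [← hX, integral_map measurable_fst.aemeasurable (by rw [hX]; exact hsL.1),
      integral_congr_ae hs, integral_condExp]
    exact measurable_fst.comap_le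
  have hsm1 : ∫ p, sm p.1 ∂P = ∫ x, sm x ∂designLaw := by
    rw [← hX, integral_map measurable_fst.aemeasurable hcont.aestronglyMeasurable]
  have h1 : fourierFun 1 ∈ fourierModel D :=
    Submodule.subset_span ⟨1, Set.mem_Icc.2 ⟨le_rfl, hD⟩, rfl⟩
  have h2 := hsm.2 _ h1
  unfold innerL2 at h2
  simp only [fourierFun, if_true, mul_one] at h2
  rw [integral_sub (hsL.integrable le_top) hismD] at h2
  rw [integral_sub (hY.integrable one_le_two) hism, hY1, hsm1, h2]

/-- The mean of `n` i.i.d. centred square-integrable variables has second moment `E[g²] / n`. -/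
lemma integral_mean_sq_eq {Ω E : Type*} [MeasurableSpace Ω] [MeasurableSpace E]
    {μ : Measure Ω} [IsProbabilityMeasure μ] {P : Measure E} {n : ℕ}
    {Z : Fin n → Ω → E} (hZ : ∀ i, Measurable (Z i)) (hind : iIndepFun Z μ)
    (hlaw : ∀ i, μ.map (Z i) = P) {g : E → ℝ} (hg : Measurable g) (hg2 : MemLp g 2 P)
    (h0 : ∫ e, g e ∂P = 0) :
    Integrable (fun ω => (1 / (n : ℝ) * ∑ i, g (Z i ω)) ^ 2) μ ∧
    ∫ ω, (1 / (n : ℝ) * ∑ i, g (Z i ω)) ^ 2 ∂μ = (∫ e, g e ^ 2 ∂P) / n := by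
  have hL : ∀ i, MemLp (fun ω => g (Z i ω)) 2 μ := fun i => by
    rw [← hlaw i] at hg2
    exact hg2.comp_of_map (hZ i).aemeasurable
  have hS : MemLp (∑ i, fun ω => g (Z i ω)) 2 μ := memLp_finsetSum' _ fun i _ => hL i
  have hm : ∀ i, ∫ ω, g (Z i ω) ∂μ = 0 := fun i => by
    rw [← integral_map (hZ i).aemeasurable hg.aestronglyMeasurable, hlaw i, h0]
  have hv : ∀ i, variance (fun ω => g (Z i ω)) μ = ∫ e, g e ^ 2 ∂P := fun i => by
    rw [variance_of_integral_eq_zero (hL i).aemeasurable (hm i), ← hlaw i,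
      integral_map (hZ i).aemeasurable (hg.pow_const 2).aestronglyMeasurable]
  have hsum0 : ∫ ω, (∑ i, fun ω => g (Z i ω)) ω ∂μ = 0 := by
    simp_rw [Finset.sum_apply]
    rw [integral_finsetSum _ fun i _ => (hL i).integrable one_le_two]
    simp [hm]
  have hvar := IndepFun.variance_sum (μ := μ) (X := fun i ω => g (Z i ω)) (s := Finset.univ)
    (fun i _ => hL i) fun i _ j _ hij => (hind.indepFun hij).comp hg hg
  rw [variance_of_integral_eq_zero hS.aemeasurable hsum0] at hvar
  simp_rw [hv, Finset.sum_apply] at hvar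
  simp_rw [mul_pow]
  constructor
  · refine Integrable.const_mul ?_ _
    have := hS.integrable_sq
    simpa [Finset.sum_apply] using this
  · rw [integral_const_mul, hvar]
    simp only [Finset.sum_const, Finset.card_univ, Fintype.card_fin, nsmul_eq_mul]
    rcases eq_or_ne (n : ℝ) 0 with h | h
    · simp [h]
    · field_simp

/-- Markov's inequality for a bound `E[f] ≤ a`, in a form that includes `a = 0`. -/
lemma measureReal_lt_le_of_integral_le {Ω : Type*} [MeasurableSpace Ω] {μ : Measure Ω}
    [IsProbabilityMeasure μ] {f : Ω → ℝ} (hf0 : ∀ ω, 0 ≤ f ω) (hf : Integrable f μ) {a x : ℝ}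
    (hx : 0 < x) (h : ∫ ω, f ω ∂μ ≤ a) : μ.real {ω | a * x < f ω} ≤ 1 / x := by
  have ha : 0 ≤ a := (integral_nonneg hf0).trans h
  rcases ha.eq_or_lt with rfl | ha
  · have h0 : f =ᵐ[μ] 0 :=
      (integral_eq_zero_iff_of_nonneg hf0 hf).1 (le_antisymm h (integral_nonneg hf0))
    have : μ {ω | 0 * x < f ω} = 0 := by
      refine measure_mono_null (fun ω hω => ?_) h0
      simp only [zero_mul, Set.mem_ofPred_eq] at hω
      exact hω.ne'
    rw [measureReal_def, this]
    simp [hx.le]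
  · have h1 := mul_meas_ge_le_integral_of_nonneg (ae_of_all _ hf0) hf (a * x)
    have h2 : μ.real {ω | a * x < f ω} ≤ μ.real {ω | a * x ≤ f ω} :=
      measureReal_mono fun ω (hω : a * x < f ω) => hω.le
    rw [le_div_iff₀ hx]
    have h3 : a * (x * μ.real {ω | a * x ≤ f ω}) ≤ a * 1 := by linarith
    have h4 := le_of_mul_le_mul_left h3 ha
    nlinarith

/-- Independence of the noise from the design makes the second moment of `ζ φₖ(X)` factorize. -/
lemma noise_mul_fourierFun {P : Measure (ℝ × ℝ)} [IsProbabilityMeasure P] {sm : ℝ → ℝ}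
    (hX : P.map Prod.fst = designLaw) (hY : MemLp (fun p : ℝ × ℝ => p.2) 2 P)
    (hsm : Continuous sm)
    (hind : IndepFun (fun p : ℝ × ℝ => p.2 - sm p.1) (fun p : ℝ × ℝ => p.1) P)
    (h0 : ∫ p, (p.2 - sm p.1) ∂P = 0) {k : ℕ} (hk : 1 ≤ k) :
    MemLp (fun p : ℝ × ℝ => (p.2 - sm p.1) * fourierFun k p.1) 2 P ∧
    ∫ p, (p.2 - sm p.1) * fourierFun k p.1 ∂P = 0 ∧
    ∫ p, ((p.2 - sm p.1) * fourierFun k p.1) ^ 2 ∂P = ∫ p, (p.2 - sm p.1) ^ 2 ∂P := by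
  have hφ := (continuous_fourierFun k).measurable
  have hφ' : Measurable fun p : ℝ × ℝ => fourierFun k p.1 := hφ.comp measurable_fst
  have hζ : Measurable fun p : ℝ × ℝ => p.2 - sm p.1 :=
    measurable_snd.sub (hsm.measurable.comp measurable_fst)
  have hsmL : MemLp (fun p : ℝ × ℝ => sm p.1) 2 P := by
    refine (memLp_two_iff_integrable_sq
      (hsm.measurable.comp measurable_fst).aestronglyMeasurable).2 ?_
    have := integrable_designLaw_of_continuous (hsm.pow 2)
    rw [← hX] at this
    exact this.comp_measurable measurable_fst
  refine ⟨?_, ?_, ?_⟩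
  · have := (hY.sub hsmL).mul (p := ⊤) (r := 2) (MemLp.of_bound hφ'.aestronglyMeasurable √2
      (ae_of_all P fun p => by simpa using abs_fourierFun_le k p.1))
    refine this.ae_eq (ae_of_all _ fun p => ?_)
    simp [mul_comm]
  · have := (hind.comp measurable_id hφ).integral_fun_mul_eq_mul_integral
      hζ.aestronglyMeasurable hφ'.aestronglyMeasurable
    simp only [Function.comp_def, id] at this
    rw [this, h0, zero_mul]
  · have := (hind.comp (measurable_id.pow_const 2) (hφ.pow_const 2)).integral_fun_mul_eq_mul_integral
      (hζ.pow_const 2).aestronglyMeasurable (hφ'.pow_const 2).aestronglyMeasurable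
    simp only [Function.comp_def, id] at this
    simp_rw [mul_pow]
    rw [this]
    have h1 : ∫ p, fourierFun k p.1 ^ 2 ∂P = 1 := by
      have h2 := integral_fourierFun_mul hk hk
      rw [if_pos rfl, ← hX, integral_map measurable_fst.aemeasurable
        (Measurable.aestronglyMeasurable (by fun_prop))] at h2
      simpa [sq] using h2
    rw [h1, mul_one]

end FourierERM

/-! ### The risk bound -/

theorem mainTheorem2 (ν : ℝ) (hν : 1 / 2 < ν) :
    ∃ Lν : ℝ, 0 < Lν ∧ ∀ L₁ L₂ : ℝ, 0 < L₁ → 0 < L₂ →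
    ∃ C : ℝ, 0 < C ∧ ∃ n₀ : ℕ, ∀ σ : ℝ, 0 ≤ σ → ∃ L' : ℝ, 0 < L' ∧
    -- the sample size, the dimension, the law of `(X, Y)`, the regression function, its projection
    ∀ (n D : ℕ) (P : Measure (ℝ × ℝ)) [IsProbabilityMeasure P] (s sm : ℝ → ℝ),
    n₀ ≤ n →
    (2 * √2 * L₁ / L₂) ^ (1 / ν) ≤ (D : ℝ) →
    (D : ℝ) ≤ Lν * ((n : ℝ) / Real.log n) ^ (1 / (2 * (ν + 1))) →
    P.map Prod.fst = FourierERM.designLaw →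
    MemLp (fun p : ℝ × ℝ => p.2) 2 P →
    FourierERM.IsRegressionFunction P s →
    s ∈ FourierERM.LambdaClass ν L₁ L₂ →
    FourierERM.IsProjection (FourierERM.fourierModel D) s sm →
    -- the noise `ζ = Y - s_m(X)`
    IndepFun (fun p : ℝ × ℝ => p.2 - sm p.1) (fun p : ℝ × ℝ => p.1) P →
    ∫ p, (p.2 - sm p.1) ^ 2 ∂P ≤ σ ^ 2 →
    -- an i.i.d. sample `Z i = (Xᵢ, Yᵢ)` of law `P`
    ∀ {Ω : Type*} [MeasurableSpace Ω] (μ : Measure Ω) [IsProbabilityMeasure μ]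
      (Z : Fin n → Ω → ℝ × ℝ),
    (∀ i, Measurable (Z i)) → iIndepFun Z μ → (∀ i, μ.map (Z i) = P) →
    ∀ x : ℝ, 0 < x → x < L' * n / (D : ℝ) ^ (2 * (ν + 1)) →
    ∃ E : Set Ω, MeasurableSet E ∧
      1 - Real.exp (-(FourierERM.smallBallConst ν L₁ L₂ ^ 2 * n / 4)) - 1 / (n : ℝ) ^ 2 - 2 / x
        ≤ μ.real E ∧
      ∀ ω ∈ E, ∀ shat : ℝ → ℝ,
        FourierERM.IsLeastSquares (FourierERM.fourierModel D) (fun i => Z i ω) shat →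
        FourierERM.normSqL2 (fun u => shat u - sm u) ≤ C * (σ ^ 2 * D * x / n) := by
  -- `1 / 13` is the constant of `dim_sq_mul_log_le`, and `16` that of the deterministic comparison
  refine ⟨1 / 13, by norm_num, fun L₁ L₂ hL₁ hL₂ => ⟨16, by norm_num, 2, fun σ _ => ⟨1, one_pos, ?_⟩⟩⟩
  intro n D P _ s sm hn hDlow hDup hX hY hs hΛ hsm hindζ hσ Ω _ μ _ Z hZ hind hlaw x hx _
  have hD0 : (0 : ℝ) < D := lt_of_lt_of_le (by positivity) hDlow
  have hD : 1 ≤ D := by exact_mod_cast hD0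
  have hn0 : (0 : ℝ) < n := by exact_mod_cast (show 0 < n by lia)
  have hcont := FourierERM.continuous_of_mem_fourierModel hsm.1
  have h0 := FourierERM.integral_sub_projection_eq_zero hD hX hY hs hΛ.2.1 hsm
  have hφ : ∀ k, Measurable (FourierERM.fourierFun k) :=
    fun k => (FourierERM.continuous_fourierFun k).measurable
  set S := Finset.Icc 1 D with hS
  let G : ℕ → ℕ → Ω → ℝ := fun j k ω => 1 / (n : ℝ) *
    ∑ i, FourierERM.fourierFun j (Z i ω).1 * FourierERM.fourierFun k (Z i ω).1
  let W : ℕ → Ω → ℝ := fun k ω => 1 / (n : ℝ) *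
    ∑ i, ((Z i ω).2 - sm (Z i ω).1) * FourierERM.fourierFun k (Z i ω).1
  have hsmm := hcont.measurable
  have hGm : ∀ j k, Measurable (G j k) := fun j k => by
    refine Measurable.const_mul (Finset.measurable_sum _ fun i _ => ?_) _
    exact ((hφ j).comp (hZ i).fst).mul ((hφ k).comp (hZ i).fst)
  have hWm : ∀ k, Measurable (W k) := fun k => by
    refine Measurable.const_mul (Finset.measurable_sum _ fun i _ => ?_) _
    exact ((hZ i).snd.sub (hsmm.comp (hZ i).fst)).mul ((hφ k).comp (hZ i).fst)
  -- the exceptional events: some Gram entry is off by more than `1 / (2D)`, or the noise is large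
  let A : ℕ × ℕ → Set Ω := fun p =>
    {ω | 1 / (2 * (D : ℝ)) < |G p.1 p.2 ω - if p.1 = p.2 then 1 else 0|}
  let B : Set Ω := {ω | σ ^ 2 * D / n * x < ∑ k ∈ S, W k ω ^ 2}
  have hAm : ∀ p, MeasurableSet (A p) := fun p =>
    measurableSet_lt measurable_const ((hGm p.1 p.2).sub_const _).abs
  have hBm : MeasurableSet B :=
    measurableSet_lt measurable_const (Finset.measurable_sum _ fun k _ => (hWm k).pow_const 2)
  have hA : μ.real (⋃ p ∈ S ×ˢ S, A p) ≤ 1 / (n : ℝ) ^ 2 := by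
    refine (measureReal_biUnion_finset_le _ _).trans ?_
    refine le_trans (Finset.sum_le_card_nsmul _ _
      (2 * Real.exp (-(n * (1 / (2 * (D : ℝ))) ^ 2 / 8))) fun p hp => ?_) ?_
    · obtain ⟨h1, h2⟩ := Finset.mem_product.1 hp
      have hφφ : Measurable fun z : ℝ × ℝ =>
          FourierERM.fourierFun p.1 z.1 * FourierERM.fourierFun p.2 z.1 :=
        ((hφ p.1).comp measurable_fst).mul ((hφ p.2).comp measurable_fst)
      have h := FourierERM.measureReal_lt_abs_mean_sub_le (by lia) hZ hind hlaw hφφ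
        (fun z => FourierERM.abs_fourierFun_mul_le p.1 p.2 z.1)
        (t := 1 / (2 * (D : ℝ))) (by positivity)
      have hmean : ∫ z, FourierERM.fourierFun p.1 z.1 * FourierERM.fourierFun p.2 z.1 ∂P =
          if p.1 = p.2 then 1 else 0 := by
        rw [← FourierERM.integral_fourierFun_mul (Finset.mem_Icc.1 h1).1 (Finset.mem_Icc.1 h2).1,
          ← hX, integral_map measurable_fst.aemeasurable]
        exact ((hφ p.1).mul (hφ p.2)).aestronglyMeasurable
      rwa [hmean] at h
    · have hcard : (((S ×ˢ S).card : ℕ) : ℝ) = (D : ℝ) ^ 2 := by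
        simp [hS, Finset.card_product, sq]
      rw [nsmul_eq_mul, hcard]
      exact FourierERM.union_bound_le hn hD (FourierERM.dim_sq_mul_log_le hν hn hDup)
  have hB : μ.real B ≤ 1 / x := by
    have hW : ∀ k ∈ S, Integrable (fun ω => W k ω ^ 2) μ ∧
        ∫ ω, W k ω ^ 2 ∂μ ≤ σ ^ 2 / n := fun k hk => by
      obtain ⟨h1, h2, h3⟩ :=
        FourierERM.noise_mul_fourierFun hX hY hcont hindζ h0 (Finset.mem_Icc.1 hk).1
      have hm : Measurable fun p : ℝ × ℝ => (p.2 - sm p.1) * FourierERM.fourierFun k p.1 :=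
        (measurable_snd.sub (hsmm.comp measurable_fst)).mul ((hφ k).comp measurable_fst)
      obtain ⟨h4, h5⟩ := FourierERM.integral_mean_sq_eq hZ hind hlaw hm h1 h2
      refine ⟨h4, h5.trans_le ?_⟩
      rw [h3]
      gcongr
    refine FourierERM.measureReal_lt_le_of_integral_le
      (fun ω => Finset.sum_nonneg fun k _ => sq_nonneg _)
      (integrable_finsetSum _ fun k hk => (hW k hk).1) hx ?_
    rw [integral_finsetSum _ fun k hk => (hW k hk).1]
    refine (Finset.sum_le_sum fun k hk => (hW k hk).2).trans (le_of_eq ?_)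
    simp [hS]
    ring
  have hE : MeasurableSet ((⋃ p ∈ S ×ˢ S, A p) ∪ B) :=
    (Finset.measurableSet_biUnion _ fun p _ => hAm p).union hBm
  refine ⟨((⋃ p ∈ S ×ˢ S, A p) ∪ B)ᶜ, hE.compl, ?_, ?_⟩
  · rw [probReal_compl_eq_one_sub hE]
    have h1 := measureReal_union_le (μ := μ) (⋃ p ∈ S ×ˢ S, A p) B
    have h2 := Real.exp_pos (-(FourierERM.smallBallConst ν L₁ L₂ ^ 2 * n / 4))
    have h3 : 2 / x = 1 / x + 1 / x := by ring
    have h4 : 0 < 1 / x := by positivity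
    linarith
  · intro ω hω shat hshat
    rw [Set.mem_compl_iff, Set.mem_union, not_or] at hω
    have hG : ∀ j ∈ S, ∀ k ∈ S, |G j k ω - if j = k then 1 else 0| ≤ 1 / (2 * D) := by
      intro j hj k hk
      by_contra h
      exact hω.1 (Set.mem_biUnion (x := (j, k)) (Finset.mk_mem_product hj hk) (not_le.1 h))
    refine (FourierERM.normSqL2_sub_le_of_isLeastSquares hD _ hsm.1 hG hshat).trans ?_
    have h : ∑ k ∈ S, W k ω ^ 2 ≤ σ ^ 2 * D / n * x := not_lt.1 hω.2
    have he : σ ^ 2 * D / n * x = σ ^ 2 * D * x / n := by ring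
    rw [he] at h
    gcongr
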